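/- Let $(A,\rho)$ be a finite partially ordered set with a least element $0$ and a greatest element $1$. For $m\ge 1$, a relation $\sigma\subseteq A^m$ is called a generalized quasiorder if it contains all constant tuples $(a,\dots,a)$, $a\in A$, and if, for every $m\times m$ matrix $(a_{ij})$ over $A$ all of whose rows and columns belong to $\sigma$, the diagonal $(a_{11},\dots,a_{mm})$ also belongs to $\sigma$. Let $\operatorname{Pol}\rho$ be the set of all operations $f:A^n\to A$, $n\ge 1$, that preserve $\rho$; let $\operatorname{Inv}\operatorname{Pol}\rho$ be the set of all nonempty relations $\sigma\subseteq A^m$, $m\ge 1$, that are preserved by every $f\in\operatorname{Pol}\rho$; and let $\operatorname{gQuord}\operatorname{Pol}\rho$ be the set of all generalized quasiorders in $\operatorname{Inv}\operatorname{Pol}\rho$. (Here $f$ preserves $\sigma$ if applying $f$ componentwise to any $n$ tuples of $\sigma$ yields a tuple of $\sigma$.) Let $[\rho]_{(\exists,\land,=)}$ be the set of all relations $\sigma\subseteq A^m$, $m\ge1$, definable by a primitive positive formula $\exists y_1\cdots\exists y_s\,\Phi(x_1,\dots,x_m,y_1,\dots,y_s)$, where $s\ge 0$ and $\Phi$ is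 a finite conjunction of atomic formulas of the form $(z,z')\in\rho$ or $z=z'$; and let $[\rho]_{(\land,=)}$ be the set of those definable by such a formula without quantifiers ($s=0$). Then the following are equivalent: (A) $\rho$ is a lattice order, i.e. any two elements of $A$ have a least upper bound and a greatest lower bound; (B) $\operatorname{gQuord}\operatorname{Pol}\rho=\operatorname{Inv}\operatorname{Pol}\rho$, i.e. every nonempty invariant relation of $\operatorname{Pol}\rho$ is a generalized quasiorder; (C) $[\rho]_{(\land,=)}=[\rho]_{(\exists,\land,=)}$. -/

import Mathlib

namespace GenQuord

universe u

/-- Finitary operations `f : Aⁿ → A` of positive arity `n`. -/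
abbrev Op (A : Type u) : Type u := Σ n : ℕ+, ((Fin n → A) → A)

/-- Finitary relations `σ ⊆ Aᵐ` of positive arity `m`. -/
abbrev FinRel (A : Type u) : Type u := Σ m : ℕ+, Set (Fin m → A)

variable {A : Type u}

/-- `f` preserves `σ`: applying `f` componentwise to tuples of `σ` yields a tuple of `σ`. -/
def Preserves (f : Op A) (σ : FinRel A) : Prop :=
  ∀ r : Fin f.1 → (Fin σ.1 → A), (∀ j, r j ∈ σ.2) → (fun i => f.2 (fun j => r j i)) ∈ σ.2

/-- The polymorphisms of a set of relations. -/
def Pol (Q : Set (FinRel A)) : Set (Op A) := {f | ∀ σ ∈ Q, Preserves f σ}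

/-- The invariant relations of a set of operations. -/
def Inv (F : Set (Op A)) : Set (FinRel A) := {σ | ∀ f ∈ F, Preserves f σ}

/-- `σ` contains all constant tuples. -/
def IsReflexive (σ : FinRel A) : Prop := ∀ a : A, (fun _ => a) ∈ σ.2

/-- Generalized transitivity: if all rows and all columns of a square matrix belong to `σ`,
then so does its diagonal. -/
def IsTransitive (σ : FinRel A) : Prop :=
  ∀ M : Matrix (Fin σ.1) (Fin σ.1) A,
    (∀ i, (fun j => M i j) ∈ σ.2) → (∀ j, (fun i => M i j) ∈ σ.2) → (fun i => M i i) ∈ σ.2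

/-- Generalized quasiorders. -/
def IsGenQuord (σ : FinRel A) : Prop := IsReflexive σ ∧ IsTransitive σ

/-- The invariant relations of `F` that are generalized quasiorders. -/
def gQuord (F : Set (Op A)) : Set (FinRel A) := {σ | σ ∈ Inv F ∧ IsGenQuord σ}

/-- Atomic formulas in the variables `V`, over the relations in `Q` and equality. -/
inductive Atom (Q : Set (FinRel A)) (V : Type) : Type u
  | rel (σ : FinRel A) (hσ : σ ∈ Q) (v : Fin σ.1 → V) : Atom Q V
  | eq (x y : V) : Atom Q V

/-- Truth of an atomic formula under an assignment of the variables. -/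
def Atom.Holds {Q : Set (FinRel A)} {V : Type} (a : V → A) : Atom Q V → Prop
  | .rel σ _ v => (fun k => a (v k)) ∈ σ.2
  | .eq x y => a x = a y

/-- Relations definable from `Q` by a quantifier-free primitive positive formula, that is, by a
finite conjunction of atomic formulas in the variables `x₁, …, xₘ`. -/
def qfClosure (Q : Set (FinRel A)) : Set (FinRel A) :=
  {σ | ∃ Φ : List (Atom Q (Fin σ.1)), σ.2 = {a | ∀ φ ∈ Φ, φ.Holds a}}

/-- Relations definable from `Q` by a primitive positive formula `∃ y₁ … yₛ, Φ`, with `Φ` a finite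
conjunction of atomic formulas in the variables `x₁, …, xₘ, y₁, …, yₛ`. -/
def ppClosure (Q : Set (FinRel A)) : Set (FinRel A) :=
  {σ | ∃ (s : ℕ) (Φ : List (Atom Q (Fin σ.1 ⊕ Fin s))),
    σ.2 = {a | ∃ b : Fin s → A, ∀ φ ∈ Φ, φ.Holds (Sum.elim a b)}}

/-- The order of `A` as a binary relation. -/
def leRel (A : Type u) [LE A] : FinRel A := ⟨2, {x : Fin 2 → A | x 0 ≤ x 1}⟩

/-- The order of `A` is a lattice order: any two elements have a least upper bound and a greatest
lower bound. -/
def IsLatticeOrder (A : Type u) [PartialOrder A] : Prop :=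
  ∀ a b : A, (∃ c, IsLUB {a, b} c) ∧ (∃ d, IsGLB {a, b} d)

end GenQuord

/-!
Two facts carry the proof.

In a finite lattice with least element, a map `d : ι → A` into the lattice extends along
`p : ι → P` to a monotone map on the preorder `P` as soon as `p i ≤ p j` implies `d i ≤ d j`: take
`v ↦ ⋁ {d i | p i ≤ v}` (`exists_monotone_extension`). Applied to the preorder generated by a
primitive positive formula on its variables, this eliminates all quantifiers at once. Applied to
`P = Aⁿ`, where `p i` lists the `i`-th entries of all `n` tuples of an invariant relation `σ`
and `d` is the diagonal of a matrix `M` with all rows and columns in `σ`, it yields a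
polymorphism that produces `d` from the tuples of `σ`: if `x i ≤ x j` holds throughout `σ`, then `M i i ≤ M i j ≤ M j j`.

Conversely, the relation `interpolant`, i.e. `∃ y, x₀, x₁ ≤ y ≤ x₂, x₃`, is nonempty, primitive
positive definable and invariant. If it is transitive, then any two elements `a`, `b` have a
supremum: for a minimal upper bound `c` and any other upper bound `d`, the matrix
`!![a, ⊥, a, a; ⊥, b, b, b; c, c, c, ⊤; d, d, ⊤, d]` puts `(a, b, c, d)` into the relation, whence
`c ≤ d`. Quantifier-free definable relations are always transitive, so both remaining conditions
force a lattice order (`isLatticeOrder_of_isTransitive_interpolant`).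
-/

namespace GenQuord

section Extension

variable {A : Type*} [PartialOrder A] [BoundedOrder A]

theorem exists_isLUB_of_finite (h : ∀ a b : A, ∃ c, IsLUB {a, b} c) {s : Set A}
    (hs : s.Finite) : ∃ c, IsLUB s c := by
  induction s, hs using Set.Finite.induction_on with
  | empty => exact ⟨⊥, isLUB_empty⟩
  | @insert a s _ _ ih =>
    obtain ⟨c, hc⟩ := ih
    obtain ⟨d, hd⟩ := h a c
    refine ⟨d, ?_⟩
    simp only [isLUB_iff_le_iff, mem_upperBounds, Set.mem_insert_iff, forall_eq_or_imp,
      Set.mem_singleton_iff, forall_eq] at hc hd ⊢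
    intro b
    rw [hd b, hc b]

/-- In a finite lattice with least element, a map given on a subfamily of a preorder extends to a
monotone map if it respects the order on the subfamily. -/
theorem IsLatticeOrder.exists_monotone_extension [Finite A] (hA : IsLatticeOrder A)
    {ι P : Type*} [Preorder P] (p : ι → P) (d : ι → A) (h : ∀ i j, p i ≤ p j → d i ≤ d j) :
    ∃ f : P → A, Monotone f ∧ ∀ i, f (p i) = d i := by
  choose f hf using fun v : P =>
    exists_isLUB_of_finite (fun a b => (hA a b).1) (Set.toFinite {x | ∃ i, p i ≤ v ∧ d i = x})
  refine ⟨f, fun v w hvw => (hf v).2 ?_, fun i => le_antisymm ((hf _).2 ?_) ((hf _).1 ?_)⟩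
  · rintro _ ⟨i, hi, rfl⟩
    exact (hf w).1 ⟨i, hi.trans hvw, rfl⟩
  · rintro _ ⟨j, hj, rfl⟩
    exact h j i hj
  · exact ⟨i, le_rfl, rfl⟩

/-- It suffices to find suprema of pairs, since an infimum of a pair is a supremum of its lower
bounds. -/
theorem isLatticeOrder_of_exists_isLUB [Finite A] (h : ∀ a b : A, ∃ c, IsLUB {a, b} c) :
    IsLatticeOrder A := by
  refine fun a b => ⟨h a b, ?_⟩
  obtain ⟨d, hd⟩ := exists_isLUB_of_finite h (Set.toFinite (lowerBounds {a, b}))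
  exact ⟨d, isLUB_lowerBounds.mp hd⟩

end Extension

section Closure

universe u

variable {A : Type u}

theorem mem_pol_leRel_iff [Preorder A] (f : Op A) : f ∈ Pol {leRel A} ↔ Monotone f.2 := by
  constructor
  · intro hf x y hxy
    exact hf (leRel A) rfl (fun j => ![x j, y j]) hxy
  · rintro hf _ rfl r hr
    exact hf hr

theorem qfClosure_subset_ppClosure (Q : Set (FinRel A)) : qfClosure Q ⊆ ppClosure Q := by
  rintro ⟨m, S⟩ ⟨Φ, hΦ⟩
  let lift : Atom Q (Fin m) → Atom Q (Fin m ⊕ Fin 0) := fun φ => match φ with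
    | .rel τ hτ v => .rel τ hτ (Sum.inl ∘ v)
    | .eq x y => .eq (.inl x) (.inl y)
  have hlift : ∀ (a : Fin m → A) (b : Fin 0 → A) (φ : Atom Q (Fin m)),
      (lift φ).Holds (Sum.elim a b) ↔ φ.Holds a := by
    rintro a b (⟨τ, hτ, v⟩ | ⟨x, y⟩) <;> rfl
  refine ⟨0, Φ.map lift, hΦ.trans ?_⟩
  ext a
  simp [hlift]

/-- An atomic formula whose relation is transitive defines a transitive relation, and transitivity
is inherited by intersections. -/
theorem isTransitive_of_mem_qfClosure {Q : Set (FinRel A)} (hQ : ∀ τ ∈ Q, IsTransitive τ)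
    {σ : FinRel A} (hσ : σ ∈ qfClosure Q) : IsTransitive σ := by
  obtain ⟨Φ, hΦ⟩ := hσ
  intro M hrow hcol
  simp only [hΦ, Set.mem_ofPred_eq] at hrow hcol ⊢
  intro φ hφ
  cases φ with
  | rel τ hτ v =>
    exact hQ τ hτ (fun k l => M (v k) (v l)) (fun k => hrow (v k) _ hφ) (fun l => hcol (v l) _ hφ)
  | eq x y => exact (hrow x _ hφ).trans (hcol y _ hφ)

theorem isTransitive_leRel [Preorder A] : IsTransitive (leRel A) := fun _ hrow hcol =>
  le_trans (hrow (0 : Fin 2)) (hcol (1 : Fin 2))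

end Closure

section Lattice

universe u

variable {A : Type u} [Finite A] [PartialOrder A] [BoundedOrder A]

/-- The formula `x ≤ y` as an atomic formula. -/
def leAtom {A : Type u} [LE A] {V : Type} (x y : V) : Atom {leRel A} V :=
  .rel (leRel A) rfl ![x, y]

theorem leAtom_holds {A : Type u} [LE A] {V : Type} (a : V → A) (x y : V) :
    (leAtom x y : Atom {leRel A} V).Holds a ↔ a x ≤ a y := Iff.rfl

/-- `x ≤ y` is implied by a single atomic formula of `Φ`, under every assignment. -/
def Forces {A : Type u} [LE A] {V : Type} (Φ : List (Atom {leRel A} V)) (x y : V) : Prop :=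
  ∃ φ ∈ Φ, ∀ a : V → A, φ.Holds a → a x ≤ a y

/-- Quantifier elimination over a lattice. -/
theorem IsLatticeOrder.ppClosure_subset_qfClosure (hA : IsLatticeOrder A) :
    ppClosure {leRel A} ⊆ qfClosure {leRel A} := by
  classical
  rintro ⟨m, S⟩ ⟨s, Φ, hΦ⟩
  -- The preorder generated by `Φ` on the variables.
  let E : Preorder (Fin m ⊕ Fin s) :=
    { le := Relation.ReflTransGen (Forces Φ)
      lt := fun x y => Relation.ReflTransGen (Forces Φ) x y ∧ ¬ Relation.ReflTransGen (Forces Φ) y x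
      lt_iff_le_not_ge := fun _ _ => Iff.rfl
      le_refl := fun _ => .refl
      le_trans := fun _ _ _ => .trans }
  have sound : ∀ c : Fin m ⊕ Fin s → A, (∀ φ ∈ Φ, φ.Holds c) → ∀ x y, E.le x y → c x ≤ c y := by
    intro c hc x y hxy
    induction hxy with
    | refl => exact le_rfl
    | tail _ h ih =>
      obtain ⟨φ, hφ, h⟩ := h
      exact ih.trans (h c (hc φ hφ))
  let L : List (Fin m × Fin m) :=
    ((Finset.univ : Finset (Fin m × Fin m)).filter fun q => E.le (.inl q.1) (.inl q.2)).toList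
  refine ⟨L.map fun q => leAtom q.1 q.2, hΦ.trans ?_⟩
  ext a
  simp only [Set.mem_ofPred_eq, List.forall_mem_map, leAtom_holds, L, Finset.mem_toList,
    Finset.mem_filter, Finset.mem_univ, true_and, Prod.forall]
  constructor
  · rintro ⟨b, hb⟩ i j hij
    exact sound _ hb _ _ hij
  · intro h
    obtain ⟨c, hc, hca⟩ := hA.exists_monotone_extension (P := Fin m ⊕ Fin s) Sum.inl a h
    have hcb : Sum.elim a (c ∘ Sum.inr) = c := by
      ext (i | k)
      · exact (hca i).symm
      · rfl
    refine ⟨c ∘ Sum.inr, fun φ hφ => ?_⟩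
    rw [hcb]
    have step : ∀ x y, (∀ a : Fin m ⊕ Fin s → A, φ.Holds a → a x ≤ a y) → c x ≤ c y :=
      fun x y hxy => hc (Relation.ReflTransGen.single ⟨φ, hφ, hxy⟩)
    cases φ with
    | rel τ hτ v =>
      obtain rfl := hτ
      exact step (v (0 : Fin 2)) (v (1 : Fin 2)) fun _ h => h
    | eq x y => exact le_antisymm (step x y fun _ h => le_of_eq h) (step y x fun _ h => ge_of_eq h)

/-- Over a lattice, every invariant relation of the monotone operations is transitive: the diagonal
is the image of an enumeration of the relation under a monotone operation. -/
theorem IsLatticeOrder.isTransitive_of_mem_inv (hA : IsLatticeOrder A) {σ : FinRel A}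
    (hσ : σ ∈ Inv (Pol {leRel A})) : IsTransitive σ := by
  intro M hrow hcol
  obtain ⟨n, ⟨e⟩⟩ := Finite.exists_equiv_fin σ.2
  -- Operations have positive arity, so an element of `σ` is needed; any row of `M` is one.
  have hn : 0 < n := Fin.pos (e ⟨_, hrow ⟨0, σ.1.pos⟩⟩)
  obtain ⟨f, hf, hfM⟩ := hA.exists_monotone_extension
    (fun (i : Fin σ.1) (k : Fin n) => (e.symm k).1 i) (fun i => M i i) (by
      intro i j hij
      have h : ∀ r ∈ σ.2, r i ≤ r j := fun r hr => by simpa using hij (e ⟨r, hr⟩)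
      exact (h _ (hrow i)).trans (h _ (hcol j)))
  have := hσ ⟨⟨n, hn⟩, f⟩ ((mem_pol_leRel_iff _).2 hf) (fun k => (e.symm k).1)
    (fun k => (e.symm k).2)
  exact (funext hfM : (fun i => f fun k => (e.symm k).1 i) = fun i => M i i) ▸ this

theorem isReflexive_of_mem_inv {A : Type u} [Preorder A] {σ : FinRel A}
    (hσ : σ ∈ Inv (Pol {leRel A})) (hne : σ.2.Nonempty) : IsReflexive σ := by
  obtain ⟨r, hr⟩ := hne
  exact fun a => hσ ⟨1, fun _ => a⟩ ((mem_pol_leRel_iff _).2 monotone_const) (fun _ => r)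
    (fun _ => hr)

end Lattice

section Interpolant

universe u

/-- The relation `∃ y, x₀ ≤ y ∧ x₁ ≤ y ∧ y ≤ x₂ ∧ y ≤ x₃`. -/
def interpolant (A : Type u) [LE A] : FinRel A :=
  ⟨4, {x : Fin 4 → A | ∃ y, x 0 ≤ y ∧ x 1 ≤ y ∧ y ≤ x 2 ∧ y ≤ x 3}⟩

variable {A : Type u}

theorem interpolant_mem_ppClosure [LE A] : interpolant A ∈ ppClosure {leRel A} := by
  let y : Fin 4 ⊕ Fin 1 := .inr 0
  refine ⟨1, [leAtom (.inl (0 : Fin 4)) y, leAtom (.inl (1 : Fin 4)) y,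
    leAtom y (.inl (2 : Fin 4)), leAtom y (.inl (3 : Fin 4))], ?_⟩
  ext a
  simp only [List.forall_mem_cons, List.not_mem_nil, false_implies, implies_true,
    and_true]
  exact ⟨fun ⟨z, hz⟩ => ⟨fun _ => z, hz⟩, fun ⟨b, hb⟩ => ⟨b 0, hb⟩⟩

theorem interpolant_mem_inv [Preorder A] : interpolant A ∈ Inv (Pol {leRel A}) := by
  intro f hf r hr
  rw [mem_pol_leRel_iff] at hf
  choose y h₀ h₁ h₂ h₃ using hr
  exact ⟨f.2 y, hf h₀, hf h₁, hf h₂, hf h₃⟩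

theorem interpolant_nonempty [Preorder A] [Nonempty A] : (interpolant A).2.Nonempty :=
  let ⟨a⟩ := ‹Nonempty A›
  ⟨fun _ => a, a, le_rfl, le_rfl, le_rfl, le_rfl⟩

theorem isLatticeOrder_of_isTransitive_interpolant [Finite A] [PartialOrder A] [BoundedOrder A]
    (h : IsTransitive (interpolant A)) : IsLatticeOrder A := by
  refine isLatticeOrder_of_exists_isLUB fun a b => ?_
  obtain ⟨c, hc⟩ := (Set.toFinite (upperBounds {a, b})).exists_minimal
    ⟨⊤, fun _ _ => le_top⟩
  refine ⟨c, hc.prop, fun d hd => ?_⟩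
  have hac : a ≤ c := hc.prop (by simp)
  have hbc : b ≤ c := hc.prop (by simp)
  have had : a ≤ d := hd (by simp)
  have hbd : b ≤ d := hd (by simp)
  let M : Matrix (Fin 4) (Fin 4) A := !![a, ⊥, a, a; ⊥, b, b, b; c, c, c, ⊤; d, d, ⊤, d]
  -- In row `i` and in column `i` alike, the diagonal entry `M i i` interpolates.
  have hrow : ∀ i : Fin 4, ∃ y, M i 0 ≤ y ∧ M i 1 ≤ y ∧ y ≤ M i 2 ∧ y ≤ M i 3 := fun i =>
    ⟨![a, b, c, d] i, by fin_cases i <;> simp [M]⟩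
  have hcol : ∀ j : Fin 4, ∃ y, M 0 j ≤ y ∧ M 1 j ≤ y ∧ y ≤ M 2 j ∧ y ≤ M 3 j := fun j =>
    ⟨![a, b, c, d] j, by fin_cases j <;> simp [M, *]⟩
  obtain ⟨y, hay, hby, hyc, hyd⟩ : ∃ y, a ≤ y ∧ b ≤ y ∧ y ≤ c ∧ y ≤ d := h M hrow hcol
  exact (hc.le_of_le (by simp [upperBounds, hay, hby]) hyc).trans hyd

end Interpolant

end GenQuord

theorem mainTheorem4 {A : Type*} [Finite A] [PartialOrder A] [BoundedOrder A] :
    List.TFAE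
      [ GenQuord.IsLatticeOrder A,
        GenQuord.gQuord (GenQuord.Pol {GenQuord.leRel A}) =
          {σ | σ ∈ GenQuord.Inv (GenQuord.Pol {GenQuord.leRel A}) ∧ σ.2.Nonempty},
        GenQuord.qfClosure {GenQuord.leRel A} = GenQuord.ppClosure {GenQuord.leRel A} ] := by
  tfae_have 1 → 2 := by
    intro hA
    ext σ
    exact ⟨fun ⟨hσ, hr, _⟩ => ⟨hσ, _, hr ⊥⟩,
      fun ⟨hσ, hne⟩ => ⟨hσ, GenQuord.isReflexive_of_mem_inv hσ hne, hA.isTransitive_of_mem_inv hσ⟩⟩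
  tfae_have 2 → 1 := fun h => GenQuord.isLatticeOrder_of_isTransitive_interpolant
    (h.ge ⟨GenQuord.interpolant_mem_inv, GenQuord.interpolant_nonempty⟩).2.2
  tfae_have 1 → 3 := fun hA =>
    (GenQuord.qfClosure_subset_ppClosure _).antisymm hA.ppClosure_subset_qfClosure
  tfae_have 3 → 1 := fun h => GenQuord.isLatticeOrder_of_isTransitive_interpolant
    (GenQuord.isTransitive_of_mem_qfClosure (by rintro _ rfl; exact GenQuord.isTransitive_leRel)
      (h.ge GenQuord.interpolant_mem_ppClosure))
  tfae_finish
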